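/- For integers $N\ge 1$, $K\ge 0$ with $2K+1\le N$, a \emph{DPSS taper} with parameters $(N,K)$ is a unit vector $\phi\in\mathbb{C}^N$ that is an eigenvector, for the largest eigenvalue, of the symmetric matrix with entries $\frac{\sin(\pi(m-n)(2K+1)/N)}{\pi(m-n)}$ for $m\neq n$ and $\frac{2K+1}{N}$ for $m=n$ ($0\le m,n\le N-1$). Write $\hat\phi(f)=\frac{1}{\sqrt N}\sum_{n=0}^{N-1}\phi[n]e^{2\pi i n f}$, so that $(\hat\phi(k/N))_{0\le k<N}$ is the quantum Fourier transform of $\phi$. The \emph{central grid points} are the indices $k$ congruent modulo $N$ to one of $-K,\dots,K$. Let $\phi^*$ be the state obtained from $\phi$ by setting to zero all amplitudes $\hat\phi(k/N)$ at non-central $k$, normalizing, and applying the inverse quantum Fourier transform; thus $\phi^*$ is prepared from the amplitudes of $\hat\phi$ at the central grid points alone. Then there is an absolute constant $C>0$ such that for every $\epsilon\in(0,1]$, with $$K=\left\lceil 175\left(\log(10/\epsilon)+1\right)^2\right\rceil,\qquad N'=2\left\lceil 175\left(\log(10/\epsilon)+1\right)^2\right\rceil+1,$$ every integer $N\ge N'$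 and every DPSS taper $\phi$ with parameters $(N,K)$: (i) the average probability of $\phi$ outside the central lobe is at most $\epsilon$, that is, $$1-N\int_{-1/(2N)}^{1/(2N)}\sum_{j=-K}^{K}\left|\hat\phi\left(\Delta+\tfrac jN\right)\right|^2d\Delta\le\epsilon;$$ (ii) there are exactly $N'$ central grid points, so that $\phi^*$ is prepared from $N'$ amplitudes; (iii) $\|\phi^*\|_2=1$ and $\|\phi^*-\phi\|_2\le C\epsilon$. Moreover $N'=O(\log^2(1/\epsilon))$ as $\epsilon\to0^+$. -/

import Mathlib

open Real Complex Filter Topology Asymptotics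
open scoped BigOperators Matrix

noncomputable section

/-- The space of (possibly unnormalized) states of an `N`-dimensional register, i.e. `ℂ^N` with the
Euclidean norm. -/
abbrev RegState (N : ℕ) : Type := EuclideanSpace ℂ (Fin N)

/-- The discrete-time Fourier transform `φ̂(f) = N^{-1/2} ∑ₙ φ[n] e^{2πi n f}`. -/
def dtft {N : ℕ} (φ : RegState N) (f : ℝ) : ℂ :=
  ((Real.sqrt N : ℝ) : ℂ)⁻¹ * ∑ n : Fin N, φ n * Complex.exp (2 * π * Complex.I * (n : ℕ) * f)

/-- The matrix of the quantum Fourier transform `|n⟩ ↦ N^{-1/2} ∑ₖ e^{2πi n k/N} |k⟩`. -/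
def qftMatrix (N : ℕ) : Matrix (Fin N) (Fin N) ℂ :=
  Matrix.of fun k n =>
    ((Real.sqrt N : ℝ) : ℂ)⁻¹ * Complex.exp (2 * π * Complex.I * (n : ℕ) * (k : ℕ) / N)

/-- The quantum Fourier transform of a register state (its frequency-domain amplitudes). -/
def qft {N : ℕ} (φ : RegState N) : RegState N :=
  WithLp.toLp 2 (qftMatrix N *ᵥ φ.ofLp)

/-- The inverse quantum Fourier transform `QFT⁻¹ = QFT†`. -/
def invQft {N : ℕ} (ψ : RegState N) : RegState N :=
  WithLp.toLp 2 ((qftMatrix N)ᴴ *ᵥ ψ.ofLp)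

/-- The kernel `sin(π(m-n)(2K+1)/N) / (π(m-n))`, with its limit value `(2K+1)/N` on the diagonal. -/
def dpssKernel (N K : ℕ) : Matrix (Fin N) (Fin N) ℂ :=
  Matrix.of fun m n =>
    if m = n then (((2 * K + 1 : ℝ) / N : ℝ) : ℂ)
    else ((Real.sin (π * ((m : ℕ) - (n : ℕ) : ℝ) * (2 * K + 1) / N) /
      (π * ((m : ℕ) - (n : ℕ) : ℝ)) : ℝ) : ℂ)

/-- `φ` is a DPSS taper on a lattice of size `N` with bandwidth parameter `K`: a unit eigenvector
of the kernel for its largest eigenvalue. (The kernel is Hermitian, so its eigenvalues are real.) -/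
def IsDPSSTaper (N K : ℕ) (φ : RegState N) : Prop :=
  ‖φ‖ = 1 ∧ ∃ l : ℝ,
    dpssKernel N K *ᵥ φ.ofLp = (l : ℂ) • φ.ofLp ∧
    ∀ μ : ℝ, Module.End.HasEigenvalue (Matrix.toLin' (dpssKernel N K)) (μ : ℂ) → μ ≤ l

/-- The average, over an offset `Δ` uniform on `[-1/(2N), 1/(2N)]`, of the probability
`∑_{|j| ≤ K} |φ̂(Δ + j/N)|²` of the central lobe. -/
def avgSuccessProb {N : ℕ} (K : ℕ) (φ : RegState N) : ℝ :=
  N * ∫ Δ in (-(1 / (2 * N : ℝ)))..(1 / (2 * N : ℝ)),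
    ∑ j ∈ Finset.Icc (-(K : ℤ)) (K : ℤ), ‖dtft φ (Δ + (j : ℝ) / N)‖ ^ 2

/-- The central grid points: the frequency indices `k` in `{0, …, N-1}` that are congruent modulo
`N` to one of `-K, …, K`. -/
def centralPoints (N K : ℕ) : Finset (Fin N) :=
  Finset.univ.filter fun k => (k : ℕ) ≤ K ∨ N ≤ (k : ℕ) + K

/-- The parameters: the frequency-domain amplitudes of `φ` at the central grid points. -/
def centralAmplitudes {N : ℕ} (K : ℕ) (φ : RegState N) : centralPoints N K → ℂ :=
  fun k => qft φ k.1

/-- The frequency-domain vector with the given amplitudes at the central grid points and zero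
amplitude everywhere else. -/
def extendByZero {N K : ℕ} (a : centralPoints N K → ℂ) : RegState N :=
  WithLp.toLp 2 fun k => if h : k ∈ centralPoints N K then a ⟨k, h⟩ else 0

/-- The state prepared from amplitudes at the central grid points: extend by zero, normalize, and
apply the inverse quantum Fourier transform. -/
def prepareState {N K : ℕ} (a : centralPoints N K → ℂ) : RegState N :=
  invQft (((‖extendByZero a‖ : ℝ) : ℂ)⁻¹ • extendByZero a)

/-- The approximate taper prepared from the central amplitudes of `φ`. -/
def approxTaper {N : ℕ} (K : ℕ) (φ : RegState N) : RegState N :=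
  prepareState (centralAmplitudes K φ)

end

/-! The average probability of the central lobe is N times the energy of φ̂ in the band |f| ≤ W =
(2K+1)/(2N), which is the quadratic form of the kernel (`avgSuccessProb_eq_dotProduct`). A DPSS
taper maximizes it over unit vectors (`IsDPSSTaper.avgSuccessProb_le`), so any test vector bounds
the leakage of the taper. The coefficients of (1 + z + ⋯ + z^m)^(s+1), with (s+1)m just below N,
give leakage at most (s+1)((s+1)/(2K+1))^(2s). This is at most (ε/10)^4 once s is of order log(10/ε)
and K of order s².

That controls the leakage averaged over the grid shift Δ, while the truncation defining φ* concerns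
Δ = 0. By averaging, some shift with |Δ| ≤ η/N has small leakage (`exists_outMass_lt`). Shifting the
grid is the same as modulating φ, which moves φ by at most 2πη, so unitarity carries the bound back
to Δ = 0 (`norm_outerPart_qft_le`). Normalizing after truncation costs only a factor 2. -/

/-- The state `φ` with its `n`-th amplitude multiplied by `e^{2πi n Δ}`. -/
noncomputable def modulate {N : ℕ} (φ : RegState N) (Δ : ℝ) : RegState N :=
  WithLp.toLp 2 fun n => φ n * Complex.exp (2 * π * Complex.I * (n : ℕ) * Δ)

/-- The probability at the non-central points of the grid shifted by `Δ`. -/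
noncomputable def outMass {N : ℕ} (K : ℕ) (φ : RegState N) (Δ : ℝ) : ℝ :=
  ∑ k ∈ (centralPoints N K)ᶜ, ‖dtft φ (Δ + (k : ℕ) / N)‖ ^ 2

/-! ### Unitarity of the quantum Fourier transform -/

theorem sum_exp_orthogonality {N : ℕ} (a b : Fin N) :
    ∑ n : Fin N, Complex.exp (2 * π * Complex.I * (((a : ℕ) : ℂ) - ((b : ℕ) : ℂ)) * (n : ℕ) / N) =
      if a = b then (N : ℂ) else 0 := by
  have hN : (N : ℂ) ≠ 0 := by
    have := a.pos
    exact_mod_cast this.ne'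
  split_ifs with h
  · subst h
    simp
  · set x : ℂ := Complex.exp (2 * π * Complex.I * (((a : ℕ) : ℂ) - ((b : ℕ) : ℂ)) / N) with hx
    have hpow : ∀ n : ℕ,
        Complex.exp (2 * π * Complex.I * (((a : ℕ) : ℂ) - ((b : ℕ) : ℂ)) * n / N) = x ^ n := by
      intro n
      rw [hx, ← Complex.exp_nat_mul]
      congr 1
      ring
    have hx1 : x ≠ 1 := by
      intro h1
      rw [hx, Complex.exp_eq_one_iff] at h1
      obtain ⟨n, hn⟩ := h1
      have h2 : (2 * π * Complex.I : ℂ) ≠ 0 := Complex.two_pi_I_ne_zero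
      have h3 : ((a : ℕ) : ℂ) - ((b : ℕ) : ℂ) = n * N := by
        field_simp at hn
        linear_combination hn
      have h4 : ((a : ℕ) : ℤ) - ((b : ℕ) : ℤ) = n * N := by exact_mod_cast h3
      have hab : ((a : ℕ) : ℤ) ≠ (b : ℕ) := by
        intro h5
        exact h (Fin.ext (by exact_mod_cast h5))
      have ha := a.isLt
      have hb := b.isLt
      have hdvd : (N : ℤ) ∣ ((a : ℕ) : ℤ) - ((b : ℕ) : ℤ) := ⟨n, by rw [h4]; ring⟩
      have := Int.eq_zero_of_abs_lt_dvd hdvd (by rw [abs_lt]; omega)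
      omega
    have hxN : x ^ N = 1 := by
      rw [← hpow, mul_div_cancel_right₀ _ hN, Complex.exp_eq_one_iff]
      exact ⟨(a : ℕ) - (b : ℕ), by push_cast; ring⟩
    simp_rw [hpow]
    rw [Fin.sum_univ_eq_sum_range (fun n => x ^ n) N, geom_sum_eq hx1, hxN]
    simp

theorem inv_sqrt_mul_inv_sqrt_natCast (N : ℕ) :
    (((Real.sqrt N : ℝ) : ℂ)⁻¹) * (((Real.sqrt N : ℝ) : ℂ)⁻¹) = (N : ℂ)⁻¹ := by
  rw [← mul_inv, ← Complex.ofReal_mul, Real.mul_self_sqrt (Nat.cast_nonneg N)]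
  simp

theorem qftMatrix_mul_conjTranspose (N : ℕ) : qftMatrix N * (qftMatrix N)ᴴ = 1 := by
  ext a b
  have hN : (N : ℂ) ≠ 0 := by
    have := a.pos
    exact_mod_cast this.ne'
  have hterm : ∀ n : Fin N, qftMatrix N a n * (qftMatrix N)ᴴ n b =
      (N : ℂ)⁻¹ *
        Complex.exp (2 * π * Complex.I * (((a : ℕ) : ℂ) - ((b : ℕ) : ℂ)) * (n : ℕ) / N) := by
    intro n
    simp only [qftMatrix, Matrix.conjTranspose_apply, Matrix.of_apply, RCLike.star_def, map_mul,
      map_inv₀, Complex.conj_ofReal, ← Complex.exp_conj, map_div₀, Complex.conj_I,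
      Complex.conj_natCast, Complex.conj_ofNat]
    rw [mul_mul_mul_comm, inv_sqrt_mul_inv_sqrt_natCast, ← Complex.exp_add]
    congr 2
    ring
  rw [Matrix.mul_apply]
  simp_rw [hterm]
  rw [← Finset.mul_sum, sum_exp_orthogonality, Matrix.one_apply]
  split_ifs <;> simp [hN]

theorem conjTranspose_mul_qftMatrix (N : ℕ) : (qftMatrix N)ᴴ * qftMatrix N = 1 :=
  mul_eq_one_comm.mp (qftMatrix_mul_conjTranspose N)

theorem norm_toLp_mulVec_of_conjTranspose_mul {n : Type*} [Fintype n] [DecidableEq n]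
    {U : Matrix n n ℂ} (hU : Uᴴ * U = 1) (x : EuclideanSpace ℂ n) :
    ‖(WithLp.toLp 2 (U *ᵥ x.ofLp) : EuclideanSpace ℂ n)‖ = ‖x‖ := by
  have h : ∀ y : EuclideanSpace ℂ n, ((‖y‖ ^ 2 : ℝ) : ℂ) = y.ofLp ⬝ᵥ star y.ofLp := by
    intro y
    rw [← EuclideanSpace.inner_eq_star_dotProduct, inner_self_eq_norm_sq_to_K]
    push_cast
    rfl
  have h2 : ((‖(WithLp.toLp 2 (U *ᵥ x.ofLp) : EuclideanSpace ℂ n)‖ ^ 2 : ℝ) : ℂ) =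
      ((‖x‖ ^ 2 : ℝ) : ℂ) := by
    rw [h, h]
    simp only
    rw [dotProduct_comm, Matrix.star_mulVec, ← Matrix.dotProduct_mulVec, Matrix.mulVec_mulVec, hU,
      Matrix.one_mulVec, dotProduct_comm]
  have h3 := Complex.ofReal_injective h2
  exact (sq_eq_sq₀ (norm_nonneg _) (norm_nonneg _)).mp h3

theorem norm_qft {N : ℕ} (φ : RegState N) : ‖qft φ‖ = ‖φ‖ :=
  norm_toLp_mulVec_of_conjTranspose_mul (conjTranspose_mul_qftMatrix N) φ

theorem norm_invQft {N : ℕ} (φ : RegState N) : ‖invQft φ‖ = ‖φ‖ :=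
  norm_toLp_mulVec_of_conjTranspose_mul
    (by rw [Matrix.conjTranspose_conjTranspose, qftMatrix_mul_conjTranspose]) φ

theorem invQft_qft {N : ℕ} (φ : RegState N) : invQft (qft φ) = φ := by
  simp [invQft, qft, Matrix.mulVec_mulVec, conjTranspose_mul_qftMatrix]

theorem invQft_sub {N : ℕ} (φ ψ : RegState N) : invQft (φ - ψ) = invQft φ - invQft ψ := by
  simp [invQft, Matrix.mulVec_sub]

theorem qft_sub {N : ℕ} (φ ψ : RegState N) : qft (φ - ψ) = qft φ - qft ψ := by
  simp [qft, Matrix.mulVec_sub]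

/-! ### Parseval on shifted grids -/

theorem norm_exp_two_pi_I_mul (n : ℕ) (x : ℝ) :
    ‖Complex.exp (2 * π * Complex.I * n * x)‖ = 1 := by
  have : (2 * π * Complex.I * n * x : ℂ) = ((2 * π * n * x : ℝ) : ℂ) * Complex.I := by
    push_cast
    ring
  rw [this, Complex.norm_exp_ofReal_mul_I]

theorem norm_modulate {N : ℕ} (φ : RegState N) (Δ : ℝ) : ‖modulate φ Δ‖ = ‖φ‖ := by
  simp [EuclideanSpace.norm_eq, modulate, norm_exp_two_pi_I_mul]

theorem dtft_add_div {N : ℕ} (φ : RegState N) (Δ : ℝ) (k : Fin N) :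
    dtft φ (Δ + (k : ℕ) / N) = qft (modulate φ Δ) k := by
  simp only [dtft, qft, modulate, qftMatrix, Matrix.mulVec, dotProduct, Matrix.of_apply,
    Finset.mul_sum]
  refine Finset.sum_congr rfl fun n _ => ?_
  have : Complex.exp (2 * π * Complex.I * (n : ℕ) * ((Δ + (k : ℕ) / N : ℝ) : ℂ)) =
      Complex.exp (2 * π * Complex.I * (n : ℕ) * (k : ℕ) / N) *
        Complex.exp (2 * π * Complex.I * (n : ℕ) * Δ) := by
    rw [← Complex.exp_add]
    congr 1
    push_cast
    ring
  rw [this]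
  ring

theorem dtft_add_intCast {N : ℕ} (φ : RegState N) (f : ℝ) (z : ℤ) :
    dtft φ (f + z) = dtft φ f := by
  simp only [dtft]
  congr 1
  refine Finset.sum_congr rfl fun n _ => ?_
  congr 1
  rw [Complex.exp_eq_exp_iff_exists_int]
  exact ⟨(n : ℕ) * z, by push_cast; ring⟩

theorem sum_norm_sq_dtft {N : ℕ} (φ : RegState N) (Δ : ℝ) :
    ∑ k : Fin N, ‖dtft φ (Δ + (k : ℕ) / N)‖ ^ 2 = ‖φ‖ ^ 2 := by
  simp_rw [dtft_add_div]
  rw [← EuclideanSpace.norm_sq_eq, norm_qft, norm_modulate]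

theorem continuous_dtft {N : ℕ} (φ : RegState N) : Continuous (dtft φ) := by
  unfold dtft
  fun_prop

theorem continuous_outMass {N : ℕ} (K : ℕ) (φ : RegState N) : Continuous (outMass K φ) := by
  have := continuous_dtft φ
  unfold outMass
  fun_prop

theorem outMass_nonneg {N : ℕ} (K : ℕ) (φ : RegState N) (Δ : ℝ) : 0 ≤ outMass K φ Δ :=
  Finset.sum_nonneg fun _ _ => by positivity

/-! ### Central lobe and its complement -/

/-- A function on `ℤ` of period `N` has the same sum over `-K, …, K` and over the central grid
points. -/
theorem sum_Icc_eq_sum_centralPoints {M : Type*} [AddCommMonoid M] {N K : ℕ} (h : 2 * K + 1 ≤ N)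
    (g : ℤ → M) (hg : ∀ j, g (j + N) = g j) :
    ∑ j ∈ Finset.Icc (-(K : ℤ)) (K : ℤ), g j = ∑ k ∈ centralPoints N K, g ((k : ℕ) : ℤ) := by
  have hN : 0 < N := by omega
  -- An index above K stands for the negative frequency k - N. The reductions modulo N change
  -- nothing on this range; they only supply the bound that `Fin N` requires.
  refine (Finset.sum_nbij' (fun k : Fin N => if (k : ℕ) ≤ K then ((k : ℕ) : ℤ) else (k : ℕ) - N)
    (fun j => if 0 ≤ j then ⟨j.toNat % N, Nat.mod_lt _ hN⟩
      else ⟨(j + N).toNat % N, Nat.mod_lt _ hN⟩) ?_ ?_ ?_ ?_ ?_).symm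
  · intro k hk
    have := k.isLt
    simp only [centralPoints, Finset.mem_filter, Finset.mem_univ, true_and] at hk
    simp only [Finset.mem_Icc]
    split_ifs <;> omega
  · intro j hj
    simp only [Finset.mem_Icc] at hj
    simp only [centralPoints, Finset.mem_filter, Finset.mem_univ, true_and]
    split_ifs with h0
    · left
      simp only
      rw [Nat.mod_eq_of_lt (by omega)]
      omega
    · right
      simp only
      rw [Nat.mod_eq_of_lt (by omega)]
      omega
  · intro k hk
    have := k.isLt
    simp only [centralPoints, Finset.mem_filter, Finset.mem_univ, true_and] at hk
    apply Fin.ext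
    by_cases hk1 : (k : ℕ) ≤ K
    · simp [hk1, Nat.mod_eq_of_lt k.isLt]
    · have : ¬ (0 : ℤ) ≤ (k : ℕ) - N := by omega
      simp only [hk1, if_false, this]
      rw [Nat.mod_eq_of_lt (by omega)]
      omega
  · intro j hj
    simp only [Finset.mem_Icc] at hj
    by_cases h0 : 0 ≤ j
    · simp only [h0, if_true]
      rw [Nat.mod_eq_of_lt (by omega)]
      split_ifs <;> omega
    · simp only [h0, if_false]
      rw [Nat.mod_eq_of_lt (by omega)]
      split_ifs <;> omega
  · intro k _
    split_ifs
    · rfl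
    · rw [← hg (_ - _), sub_add_cancel]

theorem card_centralPoints {N K : ℕ} (h : 2 * K + 1 ≤ N) :
    (centralPoints N K).card = 2 * K + 1 := by
  rw [Finset.card_eq_sum_ones,
    ← sum_Icc_eq_sum_centralPoints h (fun _ : ℤ => (1 : ℕ)) (fun _ => rfl)]
  simp
  omega

theorem sum_Icc_norm_sq_dtft {N K : ℕ} (h : 2 * K + 1 ≤ N) (φ : RegState N) (Δ : ℝ) :
    ∑ j ∈ Finset.Icc (-(K : ℤ)) (K : ℤ), ‖dtft φ (Δ + (j : ℝ) / N)‖ ^ 2 =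
      ‖φ‖ ^ 2 - outMass K φ Δ := by
  have hN : (N : ℝ) ≠ 0 := by
    have : N ≠ 0 := by omega
    exact_mod_cast this
  rw [sum_Icc_eq_sum_centralPoints h (fun j : ℤ => ‖dtft φ (Δ + (j : ℝ) / N)‖ ^ 2), eq_sub_iff_add_eq,
    ← sum_norm_sq_dtft φ Δ, outMass, ← Finset.sum_add_sum_compl (centralPoints N K)]
  · simp
  · intro j
    have : Δ + ((j + N : ℤ) : ℝ) / N = (Δ + (j : ℝ) / N) + ((1 : ℤ) : ℝ) := by
      push_cast
      field_simp
      ring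
    simp only [this, dtft_add_intCast]

theorem norm_sq_sub_avgSuccessProb {N K : ℕ} (h : 2 * K + 1 ≤ N) (φ : RegState N) :
    ‖φ‖ ^ 2 - avgSuccessProb K φ =
      N * ∫ Δ in (-(1 / (2 * N : ℝ)))..(1 / (2 * N : ℝ)), outMass K φ Δ := by
  have hN : (N : ℝ) ≠ 0 := by
    have : N ≠ 0 := by omega
    exact_mod_cast this
  unfold avgSuccessProb
  simp_rw [sum_Icc_norm_sq_dtft h]
  rw [intervalIntegral.integral_sub intervalIntegrable_const
    ((continuous_outMass K φ).intervalIntegrable _ _), intervalIntegral.integral_const]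
  simp only [smul_eq_mul]
  field_simp
  ring

/-! ### Average success probability as the quadratic form of the kernel -/

/-- The translates of an interval of length c by multiples of c abut. The induction adds one piece
at each end. -/
theorem sum_Icc_integral_shift (g : ℝ → ℝ) (hg : Continuous g) (c : ℝ) (K : ℕ) :
    ∑ j ∈ Finset.Icc (-(K : ℤ)) (K : ℤ), ∫ x in (-(c / 2))..(c / 2), g (x + j * c) =
      ∫ x in (-((2 * K + 1) * c / 2))..((2 * K + 1) * c / 2), g x := by
  have hi : ∀ a b : ℝ, IntervalIntegrable g MeasureTheory.volume a b :=
    fun a b => hg.intervalIntegrable a b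
  induction K with
  | zero => simp
  | succ K ih =>
    have hset : Finset.Icc (-((K + 1 : ℕ) : ℤ)) ((K + 1 : ℕ) : ℤ) =
        insert (-((K + 1 : ℕ) : ℤ)) (insert ((K + 1 : ℕ) : ℤ) (Finset.Icc (-(K : ℤ)) (K : ℤ))) := by
      ext j
      simp only [Finset.mem_insert, Finset.mem_Icc]
      omega
    rw [hset, Finset.sum_insert, Finset.sum_insert, ih,
      intervalIntegral.integral_comp_add_right, intervalIntegral.integral_comp_add_right]
    · rw [add_comm (∫ x in _.._, g x) (∫ x in (-((2 * (K : ℝ) + 1) * c / 2)).._, g x), ← add_assoc]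
      have e1 : c / 2 + ((-((K + 1 : ℕ) : ℤ) : ℤ) : ℝ) * c = -((2 * (K : ℝ) + 1) * c / 2) := by
        push_cast
        ring
      have e2 : -(c / 2) + (((K + 1 : ℕ) : ℤ) : ℝ) * c = (2 * (K : ℝ) + 1) * c / 2 := by
        push_cast
        ring
      rw [e1, e2, intervalIntegral.integral_add_adjacent_intervals (hi _ _) (hi _ _),
        intervalIntegral.integral_add_adjacent_intervals (hi _ _) (hi _ _)]
      congr 1 <;> (push_cast; ring)
    · simp only [Finset.mem_Icc]
      omega
    · simp only [Finset.mem_insert, Finset.mem_Icc]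
      omega

theorem avgSuccessProb_eq_integral {N : ℕ} (K : ℕ) (φ : RegState N) :
    avgSuccessProb K φ =
      N * ∫ f in (-((2 * K + 1 : ℝ) / (2 * N)))..((2 * K + 1 : ℝ) / (2 * N)), ‖dtft φ f‖ ^ 2 := by
  have hc := continuous_dtft φ
  unfold avgSuccessProb
  rw [intervalIntegral.integral_finsetSum
    fun j _ => Continuous.intervalIntegrable (by fun_prop) _ _]
  have h := sum_Icc_integral_shift (fun f => ‖dtft φ f‖ ^ 2) (by fun_prop) (1 / (N : ℝ)) K
  have e1 : 1 / (2 * N : ℝ) = 1 / (N : ℝ) / 2 := by ring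
  have e2 : (2 * K + 1 : ℝ) / (2 * N) = (2 * K + 1) * (1 / (N : ℝ)) / 2 := by ring
  rw [e1, e2, ← h]
  congr 2
  ext j
  congr 1
  ext x
  congr 3
  ring

/-- The kernel is the Fourier transform of the indicator of the band |f| ≤ W. -/
theorem integral_exp_eq_dpssKernel {N : ℕ} (K : ℕ) (m n : Fin N) :
    ∫ f : ℝ in (-((2 * K + 1 : ℝ) / (2 * N)))..((2 * K + 1 : ℝ) / (2 * N)),
      Complex.exp (2 * π * Complex.I * (((n : ℕ) : ℂ) - ((m : ℕ) : ℂ)) * f) =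
      dpssKernel N K m n := by
  have hN : (N : ℂ) ≠ 0 := by
    have := m.pos
    exact_mod_cast this.ne'
  by_cases h : m = n
  · subst h
    simp only [sub_self, mul_zero, zero_mul, Complex.exp_zero, dpssKernel, Matrix.of_apply, if_true,
      intervalIntegral.integral_const]
    rw [Complex.real_smul, mul_one]
    congr 1
    ring
  · have hd : ((n : ℕ) : ℂ) - ((m : ℕ) : ℂ) ≠ 0 := by
      rw [sub_ne_zero]
      intro h1
      exact h (Fin.ext (by exact_mod_cast h1.symm))
    have hd' : ((m : ℕ) : ℂ) - ((n : ℕ) : ℂ) ≠ 0 := by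
      rw [← neg_sub]
      exact neg_ne_zero.mpr hd
    have hpi : (π : ℂ) ≠ 0 := by exact_mod_cast Real.pi_ne_zero
    rw [integral_exp_mul_complex (mul_ne_zero Complex.two_pi_I_ne_zero hd)]
    simp only [dpssKernel, Matrix.of_apply, h, if_false]
    push_cast
    rw [Complex.sin]
    have a1 : 2 * π * Complex.I * (((n : ℕ) : ℂ) - ((m : ℕ) : ℂ)) * ((2 * K + 1) / (2 * N)) =
        -(π * (((m : ℕ) : ℂ) - ((n : ℕ) : ℂ)) * (2 * K + 1) / N) * Complex.I := by
      field_simp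
      ring
    have a2 : 2 * π * Complex.I * (((n : ℕ) : ℂ) - ((m : ℕ) : ℂ)) * -((2 * K + 1) / (2 * N)) =
        (π * (((m : ℕ) : ℂ) - ((n : ℕ) : ℂ)) * (2 * K + 1) / N) * Complex.I := by
      field_simp
      ring
    rw [a1, a2, div_eq_div_iff (mul_ne_zero Complex.two_pi_I_ne_zero hd) (mul_ne_zero hpi hd')]
    linear_combination (Complex.exp (-(π * (((m : ℕ) : ℂ) - ((n : ℕ) : ℂ)) * (2 * K + 1) / N) *
      Complex.I) - Complex.exp ((π * (((m : ℕ) : ℂ) - ((n : ℕ) : ℂ)) * (2 * K + 1) / N) *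
      Complex.I)) * (((m : ℕ) : ℂ) - ((n : ℕ) : ℂ)) * π * Complex.I_sq

theorem norm_sq_dtft {N : ℕ} (φ : RegState N) (f : ℝ) :
    ((‖dtft φ f‖ ^ 2 : ℝ) : ℂ) = (N : ℂ)⁻¹ * ∑ m : Fin N, ∑ n : Fin N,
      star (φ m) * φ n * Complex.exp (2 * π * Complex.I * (((n : ℕ) : ℂ) - ((m : ℕ) : ℂ)) * f) := by
  have h1 : ((‖dtft φ f‖ ^ 2 : ℝ) : ℂ) = star (dtft φ f) * dtft φ f := by
    rw [RCLike.star_def, Complex.conj_mul']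
    push_cast
    rfl
  rw [h1, dtft, star_mul', mul_mul_mul_comm, RCLike.star_def, map_inv₀, Complex.conj_ofReal,
    inv_sqrt_mul_inv_sqrt_natCast, map_sum, Finset.sum_mul_sum]
  congr 1
  refine Finset.sum_congr rfl fun m _ => Finset.sum_congr rfl fun n _ => ?_
  simp only [RCLike.star_def, map_mul, ← Complex.exp_conj, Complex.conj_I, Complex.conj_ofReal,
    Complex.conj_natCast, Complex.conj_ofNat]
  rw [mul_mul_mul_comm, ← Complex.exp_add]
  congr 2
  ring

/-- The average success probability is the quadratic form of the kernel. -/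
theorem avgSuccessProb_eq_dotProduct {N : ℕ} (hN : N ≠ 0) (K : ℕ) (φ : RegState N) :
    (avgSuccessProb K φ : ℂ) = star φ.ofLp ⬝ᵥ (dpssKernel N K *ᵥ φ.ofLp) := by
  have hN' : (N : ℂ) ≠ 0 := by exact_mod_cast hN
  rw [avgSuccessProb_eq_integral]
  push_cast
  rw [← intervalIntegral.integral_ofReal]
  simp_rw [norm_sq_dtft]
  rw [intervalIntegral.integral_const_mul, mul_inv_cancel_left₀ hN',
    intervalIntegral.integral_finsetSum
      fun m _ => Continuous.intervalIntegrable (by fun_prop) _ _]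
  simp only [dotProduct, Matrix.mulVec, Finset.mul_sum]
  refine Finset.sum_congr rfl fun m _ => ?_
  rw [intervalIntegral.integral_finsetSum
      fun m _ => Continuous.intervalIntegrable (by fun_prop) _ _]
  refine Finset.sum_congr rfl fun n _ => ?_
  rw [intervalIntegral.integral_const_mul, integral_exp_eq_dpssKernel]
  simp only [Pi.star_apply]
  ring

theorem isHermitian_dpssKernel (N K : ℕ) : (dpssKernel N K).IsHermitian := by
  ext m n
  simp only [Matrix.conjTranspose_apply, dpssKernel, Matrix.of_apply, RCLike.star_def]
  by_cases h : m = n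
  · subst h
    rw [if_pos rfl, Complex.conj_ofReal]
  · have h' : n ≠ m := fun e => h e.symm
    simp only [h, h', if_false, Complex.conj_ofReal]
    congr 1
    rw [← neg_sub ((m : ℕ) : ℝ) ((n : ℕ) : ℝ), mul_neg, neg_mul, neg_div, Real.sin_neg, neg_div_neg_eq]

/-! ### Variational principle -/

open scoped ComplexOrder in
/-- The quadratic form of a Hermitian matrix is bounded by its largest eigenvalue. -/
theorem posSemidef_smul_one_sub {n : Type*} [Fintype n] [DecidableEq n] {A : Matrix n n ℂ}
    (hA : A.IsHermitian) {l : ℝ}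
    (hl : ∀ μ : ℝ, Module.End.HasEigenvalue (Matrix.toLin' A) (μ : ℂ) → μ ≤ l) :
    ((l : ℂ) • (1 : Matrix n n ℂ) - A).PosSemidef := by
  have hB : ((l : ℂ) • (1 : Matrix n n ℂ) - A).IsHermitian := by
    refine Matrix.IsHermitian.sub ?_ hA
    rw [Matrix.IsHermitian, Matrix.conjTranspose_smul, Matrix.conjTranspose_one]
    simp
  rw [hB.posSemidef_iff_eigenvalues_nonneg]
  intro i
  have hv := hB.mulVec_eigenvectorBasis i
  have hne : (hB.eigenvectorBasis i).ofLp ≠ 0 := by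
    intro h0
    exact hB.eigenvectorBasis.orthonormal.ne_zero i (by ext j; simp [h0])
  -- An eigenvalue ν of l - A gives the eigenvalue l - ν of A, so l - ν ≤ l and ν ≥ 0.
  have hev : Module.End.HasEigenvalue (Matrix.toLin' A) ((l - hB.eigenvalues i : ℝ) : ℂ) := by
    refine Module.End.hasEigenvalue_of_hasEigenvector
      (x := (hB.eigenvectorBasis i).ofLp) ⟨?_, hne⟩
    rw [Module.End.mem_eigenspace_iff, Matrix.toLin'_apply]
    rw [Matrix.sub_mulVec, Matrix.smul_mulVec, Matrix.one_mulVec] at hv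
    rw [Complex.ofReal_sub, sub_smul, Complex.coe_smul (hB.eigenvalues i), ← hv]
    simp
  have := hl _ hev
  simp only [Pi.zero_apply]
  linarith

-- The taper attains the maximum l of the Rayleigh quotient. Maximality of the eigenvalue enters the
-- proof only here.
open scoped ComplexOrder in
theorem IsDPSSTaper.avgSuccessProb_le {N K : ℕ} (hN : N ≠ 0) {φ : RegState N}
    (hφ : IsDPSSTaper N K φ) (ψ : RegState N) :
    avgSuccessProb K ψ ≤ avgSuccessProb K φ * ‖ψ‖ ^ 2 := by
  obtain ⟨h1, l, hev, hl⟩ := hφ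
  have hsq : ∀ y : RegState N, star y.ofLp ⬝ᵥ y.ofLp = ((‖y‖ ^ 2 : ℝ) : ℂ) := by
    intro y
    rw [dotProduct_comm, ← EuclideanSpace.inner_eq_star_dotProduct, inner_self_eq_norm_sq_to_K]
    push_cast
    rfl
  have hφl : avgSuccessProb K φ = l := by
    have := avgSuccessProb_eq_dotProduct hN K φ
    rw [hev, dotProduct_smul, hsq, h1] at this
    simpa using this
  have hpos := (posSemidef_smul_one_sub (isHermitian_dpssKernel N K) hl).re_dotProduct_nonneg ψ.ofLp
  rw [Matrix.sub_mulVec, Matrix.smul_mulVec, Matrix.one_mulVec, dotProduct_sub, dotProduct_smul,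
    hsq, ← avgSuccessProb_eq_dotProduct hN K ψ, smul_eq_mul, ← Complex.ofReal_mul,
    ← Complex.ofReal_sub] at hpos
  rw [RCLike.re_to_complex, Complex.ofReal_re] at hpos
  rw [hφl]
  linarith

/-! ### Polynomial test vectors -/

open Polynomial in
/-- The register state of the first `N` coefficients of a polynomial. -/
noncomputable def polyState (N : ℕ) (p : ℂ[X]) : RegState N :=
  WithLp.toLp 2 fun n => p.coeff n

open Polynomial in
theorem dtft_polyState {N : ℕ} {p : ℂ[X]} (hp : p.natDegree < N) (f : ℝ) :
    dtft (polyState N p) f =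
      ((Real.sqrt N : ℝ) : ℂ)⁻¹ * p.eval (Complex.exp (2 * π * Complex.I * f)) := by
  rw [dtft, eval_eq_sum_range' hp, ← Fin.sum_univ_eq_sum_range
    (fun n => p.coeff n * Complex.exp (2 * π * Complex.I * f) ^ n) N]
  congr 1
  refine Finset.sum_congr rfl fun n _ => ?_
  rw [← Complex.exp_nat_mul]
  simp only [polyState]
  congr 2
  ring

open Polynomial in
theorem norm_sq_dtft_polyState {N : ℕ} {p : ℂ[X]} (hp : p.natDegree < N) (f : ℝ) :
    ‖dtft (polyState N p) f‖ ^ 2 =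
      (N : ℝ)⁻¹ * ‖p.eval (Complex.exp (2 * π * Complex.I * f))‖ ^ 2 := by
  rw [dtft_polyState hp, norm_mul, mul_pow, norm_inv, Complex.norm_real, inv_pow, Real.norm_eq_abs,
    sq_abs, Real.sq_sqrt (Nat.cast_nonneg N)]

-- Only the k = 0 term of Parseval's identity is kept.
open Polynomial in
theorem norm_sq_eval_one_le {N : ℕ} {p : ℂ[X]} (hp : p.natDegree < N) :
    (N : ℝ)⁻¹ * ‖p.eval 1‖ ^ 2 ≤ ‖polyState N p‖ ^ 2 := by
  have hN : 0 < N := by omega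
  have h := Finset.single_le_sum
    (f := fun k : Fin N => ‖dtft (polyState N p) (0 + ((k : ℕ) : ℝ) / N)‖ ^ 2)
    (fun _ _ => by positivity) (Finset.mem_univ (⟨0, hN⟩ : Fin N))
  rw [sum_norm_sq_dtft (polyState N p) 0] at h
  simp only [norm_sq_dtft_polyState hp] at h
  simpa using h

open Polynomial in
theorem norm_sq_polyState_geom_sum {N m : ℕ} (h : m ≤ N) :
    ‖polyState N (∑ i ∈ Finset.range m, (X : ℂ[X]) ^ i)‖ ^ 2 = m := by
  rw [EuclideanSpace.norm_sq_eq]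
  have hc : ∀ n : ℕ, ‖(∑ i ∈ Finset.range m, (X : ℂ[X]) ^ i).coeff n‖ ^ 2 =
      if n ∈ Finset.range m then (1 : ℝ) else 0 := by
    intro n
    simp only [finsetSum_coeff, coeff_X_pow, Finset.sum_ite_eq]
    split_ifs <;> simp
  simp only [polyState, hc]
  rw [Fin.sum_univ_eq_sum_range (fun n => if n ∈ Finset.range m then (1 : ℝ) else 0) N,
    Finset.sum_ite_mem, Finset.inter_eq_right.mpr (Finset.range_mono h)]
  simp

open Polynomial in
theorem natDegree_geom_sum_le (m : ℕ) :
    (∑ i ∈ Finset.range (m + 1), (X : ℂ[X]) ^ i).natDegree ≤ m := by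
  refine natDegree_sum_le_of_forall_le _ _ fun i hi => ?_
  rw [natDegree_X_pow]
  exact Nat.lt_succ_iff.mp (Finset.mem_range.mp hi)

theorem two_mul_le_sin_pi_mul {W f : ℝ} (hW : 0 ≤ W) (h1 : W ≤ f) (h2 : f ≤ 1 - W) :
    2 * W ≤ Real.sin (π * f) := by
  have hpi := Real.pi_pos
  have key : ∀ g : ℝ, W ≤ g → g ≤ 1 / 2 → 2 * W ≤ Real.sin (π * g) := by
    intro g hg1 hg2
    have := Real.mul_le_sin (x := π * g) (by nlinarith) (by nlinarith)
    have e : 2 / π * (π * g) = 2 * g := by field_simp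
    linarith
  rcases le_total f (1 / 2) with h | h
  · exact key f h1 h
  · have := key (1 - f) (by linarith) (by linarith)
    rwa [mul_sub, mul_one, Real.sin_pi_sub] at this

/-- The sum equals (z^m - 1)/(z - 1), with numerator at most 2 and |z - 1| = 2|sin πf| ≥ 4W. The
bound does not depend on m. -/
theorem norm_geom_sum_exp_le {W f : ℝ} (hW : 0 < W) (h1 : W ≤ f) (h2 : f ≤ 1 - W) (m : ℕ) :
    ‖∑ i ∈ Finset.range m, Complex.exp (2 * π * Complex.I * f) ^ i‖ ≤ 1 / (2 * W) := by
  have hs := two_mul_le_sin_pi_mul hW.le h1 h2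
  set z := Complex.exp (2 * π * Complex.I * f) with hz
  have hz1 : ‖z‖ = 1 := by
    simpa [hz] using norm_exp_two_pi_I_mul 1 f
  have hsub : 4 * W ≤ ‖z - 1‖ := by
    have e : (2 * π * Complex.I * f : ℂ) = Complex.I * ((2 * π * f : ℝ) : ℂ) := by
      push_cast
      ring
    rw [hz, e, Complex.norm_exp_I_mul_ofReal_sub_one, Real.norm_eq_abs]
    have e2 : 2 * π * f / 2 = π * f := by ring
    rw [e2]
    exact le_trans (by linarith) (le_abs_self _)
  have hmul : ‖∑ i ∈ Finset.range m, z ^ i‖ * ‖z - 1‖ ≤ 2 := by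
    rw [← norm_mul, geom_sum_mul]
    refine (norm_sub_le _ _).trans ?_
    rw [norm_pow, hz1]
    norm_num
  rw [le_div_iff₀ (by positivity)]
  nlinarith [norm_nonneg (∑ i ∈ Finset.range m, z ^ i)]

-- With D the geometric sum, |D|^(2s+2) splits as |D|^(2s) · |D|². The first factor is bounded
-- pointwise off the central lobe. The second is summed over the whole grid by Parseval, which
-- avoids losing a factor for the number of grid points.
open Polynomial in
theorem outMass_polyState_geom_sum_pow_le {N K m s : ℕ} (hdeg : (s + 1) * m < N) {Δ : ℝ}
    (hΔ : |Δ| ≤ 1 / (2 * N)) :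
    outMass K (polyState N ((∑ i ∈ Finset.range (m + 1), (X : ℂ[X]) ^ i) ^ (s + 1))) Δ ≤
      (N / (2 * K + 1) : ℝ) ^ (2 * s) * ((m + 1 : ℕ) : ℝ) := by
  have hmN : m < N := lt_of_le_of_lt (Nat.le_mul_of_pos_left m (Nat.succ_pos s)) hdeg
  have hN : (0 : ℝ) < N := by
    have : 0 < N := by omega
    exact_mod_cast this
  have hd1 := lt_of_le_of_lt (natDegree_geom_sum_le m) hmN
  have hd2 : ((∑ i ∈ Finset.range (m + 1), (X : ℂ[X]) ^ i) ^ (s + 1)).natDegree < N :=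
    lt_of_le_of_lt (natDegree_pow_le_of_le (s + 1) (natDegree_geom_sum_le m)) hdeg
  rw [← norm_sq_polyState_geom_sum (N := N) (m := m + 1) (by omega),
    ← sum_norm_sq_dtft _ Δ, Finset.mul_sum, outMass]
  refine le_trans (Finset.sum_le_sum fun k hk => ?_)
    (Finset.sum_le_sum_of_subset_of_nonneg (Finset.subset_univ (centralPoints N K)ᶜ)
      fun _ _ _ => by positivity)
  rw [norm_sq_dtft_polyState hd1, norm_sq_dtft_polyState hd2]
  simp only [centralPoints, Finset.compl_filter, Finset.mem_filter, Finset.mem_univ, true_and,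
    not_or, not_le] at hk
  obtain ⟨hk1, hk2⟩ := hk
  have hk1' : (K : ℝ) + 1 ≤ (k : ℕ) := by exact_mod_cast hk1
  have hk2' : ((k : ℕ) : ℝ) + K + 1 ≤ N := by exact_mod_cast hk2
  rw [abs_le] at hΔ
  have hB := norm_geom_sum_exp_le (W := (2 * K + 1) / (2 * N)) (f := Δ + (k : ℕ) / N)
    (by positivity)
    (by
      have : ((K : ℝ) + 1) / N ≤ (k : ℕ) / N := by gcongr
      have e : (2 * K + 1 : ℝ) / (2 * N) = -(1 / (2 * N)) + ((K : ℝ) + 1) / N := by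
        field_simp
        ring
      linarith)
    (by
      have : (((k : ℕ) : ℝ) + K + 1) / N ≤ N / N := by gcongr
      have e : ((k : ℕ) : ℝ) / N + (2 * K + 1 : ℝ) / (2 * N) =
          -(1 / (2 * N)) + (((k : ℕ) : ℝ) + K + 1) / N := by
        field_simp
        ring
      rw [div_self hN.ne'] at this
      linarith) (m + 1)
  have e : 1 / (2 * ((2 * K + 1 : ℝ) / (2 * N))) = N / (2 * K + 1) := by field_simp
  rw [e] at hB
  simp only [eval_pow, eval_finsetSum, eval_X, norm_pow]
  have hpow := pow_le_pow_left₀ (norm_nonneg _) hB (2 * s)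
  calc _ = ‖∑ i ∈ Finset.range (m + 1),
        Complex.exp (2 * π * Complex.I * ((Δ + (k : ℕ) / N : ℝ) : ℂ)) ^ i‖ ^ (2 * s) *
        ((N : ℝ)⁻¹ * ‖∑ i ∈ Finset.range (m + 1),
        Complex.exp (2 * π * Complex.I * ((Δ + (k : ℕ) / N : ℝ) : ℂ)) ^ i‖ ^ 2) := by ring
    _ ≤ _ := by gcongr

/-- The average probability of a taper outside the central lobe, bounded through the coefficients
of the power `(1 + z + ⋯ + z^m)^(s+1)`. -/
theorem IsDPSSTaper.one_sub_avgSuccessProb_le {N K : ℕ} (h : 2 * K + 1 ≤ N) {φ : RegState N}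
    (hφ : IsDPSSTaper N K φ) (s : ℕ) :
    1 - avgSuccessProb K φ ≤ (s + 1) * ((s + 1) / (2 * K + 1)) ^ (2 * s) := by
  have hN0 : 0 < N := by omega
  have hN : (0 : ℝ) < N := by exact_mod_cast hN0
  -- The largest m for which the power has degree below N. Maximality gives N ≤ (s+1)(m+1), which
  -- removes N from the final bound.
  obtain ⟨m, hm⟩ : ∃ m, m = (N - 1) / (s + 1) := ⟨_, rfl⟩
  have hdeg : (s + 1) * m < N := by
    have := Nat.mul_div_le (N - 1) (s + 1)
    rw [← hm] at this
    omega
  have hcov : N ≤ (s + 1) * (m + 1) := by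
    have := Nat.lt_mul_div_succ (N - 1) (Nat.succ_pos s)
    rw [Nat.succ_eq_add_one, ← hm] at this
    omega
  have hcov' : (N : ℝ) ≤ (s + 1) * (m + 1) := by exact_mod_cast hcov
  set p : Polynomial ℂ := (∑ i ∈ Finset.range (m + 1), (Polynomial.X : Polynomial ℂ) ^ i) ^ (s + 1)
    with hp
  have hdp : p.natDegree < N := lt_of_le_of_lt
    (Polynomial.natDegree_pow_le_of_le (s + 1) (natDegree_geom_sum_le m)) hdeg
  set B : ℝ := (N / (2 * K + 1) : ℝ) ^ (2 * s) * ((m + 1 : ℕ) : ℝ) with hB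
  have hout : ‖polyState N p‖ ^ 2 - avgSuccessProb K (polyState N p) ≤ B := by
    rw [norm_sq_sub_avgSuccessProb h]
    have hle : -(1 / (2 * N : ℝ)) ≤ 1 / (2 * N : ℝ) := by
      have : (0 : ℝ) ≤ 1 / (2 * N : ℝ) := by positivity
      linarith
    have := intervalIntegral.integral_mono_on hle
      ((continuous_outMass K (polyState N p)).intervalIntegrable _ _)
      (intervalIntegrable_const (c := B) (μ := MeasureTheory.volume))
      fun Δ hΔ => outMass_polyState_geom_sum_pow_le hdeg (abs_le.mpr hΔ)
    rw [intervalIntegral.integral_const, smul_eq_mul] at this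
    calc _ ≤ (N : ℝ) * ((1 / (2 * N : ℝ) - -(1 / (2 * N : ℝ))) * B) := by gcongr
      _ = B := by
        field_simp
        ring
  have hlow := norm_sq_eval_one_le hdp
  have he : ‖p.eval 1‖ = ((m : ℝ) + 1) ^ (s + 1) := by
    simp only [hp, Polynomial.eval_pow, Polynomial.eval_finsetSum, Polynomial.eval_X, one_pow,
      Finset.sum_const, Finset.card_range, nsmul_eq_mul, mul_one, norm_pow, Complex.norm_natCast]
    push_cast
    rfl
  rw [he] at hlow
  have hray := hφ.avgSuccessProb_le hN0.ne' (polyState N p)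
  have hdef : 0 ≤ 1 - avgSuccessProb K φ := by
    have := norm_sq_sub_avgSuccessProb h φ
    rw [hφ.1, one_pow] at this
    rw [this]
    refine mul_nonneg hN.le (intervalIntegral.integral_nonneg ?_ fun Δ _ => outMass_nonneg K φ Δ)
    have : (0 : ℝ) ≤ 1 / (2 * N : ℝ) := by positivity
    linarith
  have hmain : (1 - avgSuccessProb K φ) * ((N : ℝ)⁻¹ * (((m : ℝ) + 1) ^ (s + 1)) ^ 2) ≤ B :=
    (mul_le_mul_of_nonneg_left hlow hdef).trans (by linarith)
  have hm0 : (0 : ℝ) < (m : ℝ) + 1 := by positivity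
  rw [← le_div_iff₀ (by positivity)] at hmain
  have hratio : (N : ℝ) / (m + 1) ≤ s + 1 := by
    rw [div_le_iff₀ hm0]
    exact hcov'
  calc _ ≤ _ := hmain
    _ = (N / (m + 1)) * ((N / (m + 1)) / (2 * K + 1)) ^ (2 * s) := by
      rw [hB]
      push_cast
      simp only [div_pow]
      field_simp
      ring
    _ ≤ _ := by gcongr

/-! ### From the average over shifts to truncation on the unshifted grid -/

/-- A vector of amplitudes with those at the central grid points set to zero. -/
noncomputable def outerPart {N : ℕ} (K : ℕ) (x : RegState N) : RegState N :=
  WithLp.toLp 2 fun k => if k ∈ centralPoints N K then 0 else x k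

theorem norm_sq_outerPart {N : ℕ} (K : ℕ) (x : RegState N) :
    ‖outerPart K x‖ ^ 2 = ∑ k ∈ (centralPoints N K)ᶜ, ‖x k‖ ^ 2 := by
  rw [EuclideanSpace.norm_sq_eq, ← Finset.sum_add_sum_compl (centralPoints N K),
    Finset.sum_eq_zero, zero_add]
  · refine Finset.sum_congr rfl fun k hk => ?_
    rw [Finset.mem_compl] at hk
    simp [outerPart, hk]
  · intro k hk
    simp [outerPart, hk]

theorem norm_outerPart_le {N : ℕ} (K : ℕ) (x : RegState N) : ‖outerPart K x‖ ≤ ‖x‖ := by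
  rw [← sq_le_sq₀ (norm_nonneg _) (norm_nonneg _), norm_sq_outerPart, EuclideanSpace.norm_sq_eq]
  exact Finset.sum_le_sum_of_subset_of_nonneg (Finset.subset_univ _) fun _ _ _ => by positivity

theorem outerPart_add {N : ℕ} (K : ℕ) (x y : RegState N) :
    outerPart K (x + y) = outerPart K x + outerPart K y := by
  ext k
  simp only [outerPart, PiLp.add_apply]
  split_ifs <;> simp

theorem norm_sq_outerPart_qft_modulate {N : ℕ} (K : ℕ) (φ : RegState N) (Δ : ℝ) :
    ‖outerPart K (qft (modulate φ Δ))‖ ^ 2 = outMass K φ Δ := by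
  rw [norm_sq_outerPart, outMass]
  simp_rw [dtft_add_div]

theorem sub_extendByZero_centralAmplitudes {N : ℕ} (K : ℕ) (φ : RegState N) :
    qft φ - extendByZero (centralAmplitudes K φ) = outerPart K (qft φ) := by
  ext k
  simp only [outerPart, extendByZero, centralAmplitudes, PiLp.sub_apply]
  split_ifs <;> simp

/-- Amplitudewise, |e^(ix) - 1| ≤ |x| with x = 2πnΔ and n ≤ N. -/
theorem norm_sub_modulate_le {N : ℕ} (φ : RegState N) (Δ : ℝ) :
    ‖φ - modulate φ Δ‖ ≤ 2 * π * N * |Δ| * ‖φ‖ := by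
  have hpi := Real.pi_pos
  rw [← sq_le_sq₀ (norm_nonneg _) (by positivity), mul_pow, EuclideanSpace.norm_sq_eq,
    EuclideanSpace.norm_sq_eq, Finset.mul_sum]
  refine Finset.sum_le_sum fun n _ => ?_
  rw [← mul_pow]
  refine pow_le_pow_left₀ (norm_nonneg _) ?_ 2
  have e : (φ - modulate φ Δ) n =
      -(Complex.exp (Complex.I * ((2 * π * (n : ℕ) * Δ : ℝ) : ℂ)) - 1) * φ n := by
    simp only [modulate, PiLp.sub_apply]
    have : (2 * π * Complex.I * (n : ℕ) * Δ : ℂ) =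
        Complex.I * ((2 * π * (n : ℕ) * Δ : ℝ) : ℂ) := by
      push_cast
      ring
    rw [this]
    ring
  rw [e, norm_mul, norm_neg]
  refine mul_le_mul_of_nonneg_right ?_ (norm_nonneg _)
  refine (Real.norm_exp_I_mul_ofReal_sub_one_le).trans ?_
  rw [Real.norm_eq_abs, abs_mul, abs_of_nonneg (by positivity : (0 : ℝ) ≤ 2 * π * (n : ℕ))]
  have : ((n : ℕ) : ℝ) ≤ N := by exact_mod_cast n.isLt.le
  gcongr

/-- If the average probability outside the central lobe is small, then the probability at the
non-central points is small for some nearby shift of the grid. -/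
theorem exists_outMass_lt {N K : ℕ} (h : 2 * K + 1 ≤ N) (φ : RegState N) {η t : ℝ} (hη : 0 ≤ η)
    (hη2 : η ≤ 1 / 2) (hlt : ‖φ‖ ^ 2 - avgSuccessProb K φ < 2 * η * t) :
    ∃ Δ : ℝ, |Δ| ≤ η / N ∧ outMass K φ Δ < t := by
  -- Markov's inequality: the shifts |Δ| ≤ η/N have measure 2η/N inside the averaging window, so
  -- leakage at least t on all of them would contribute 2ηt to the average.
  by_contra! hcon
  have hN : (0 : ℝ) < N := by
    have : 0 < N := by omega
    exact_mod_cast this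
  have hint : ∀ a b, IntervalIntegrable (outMass K φ) MeasureTheory.volume a b :=
    fun a b => (continuous_outMass K φ).intervalIntegrable a b
  have h0 : 0 ≤ η / N := by positivity
  have hle : η / N ≤ 1 / (2 * N) := by
    calc η / N ≤ (1 / 2) / N := by gcongr
      _ = 1 / (2 * N) := by ring
  have h1 : ∫ _ in (-(η / N))..(η / N), t ≤ ∫ Δ in (-(η / N))..(η / N), outMass K φ Δ :=
    intervalIntegral.integral_mono_on (by linarith) intervalIntegrable_const (hint _ _)
      fun Δ hΔ => hcon Δ (abs_le.mpr hΔ)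
  have h2 : ∫ Δ in (-(η / N))..(η / N), outMass K φ Δ ≤
      ∫ Δ in (-(1 / (2 * N : ℝ)))..(1 / (2 * N : ℝ)), outMass K φ Δ :=
    intervalIntegral.integral_mono_interval (by linarith) (by linarith) hle
      (Filter.Eventually.of_forall fun Δ => outMass_nonneg K φ Δ) (hint _ _)
  rw [intervalIntegral.integral_const, smul_eq_mul] at h1
  rw [norm_sq_sub_avgSuccessProb h] at hlt
  have h3 : 2 * η * t ≤
      N * ∫ Δ in (-(1 / (2 * N : ℝ)))..(1 / (2 * N : ℝ)), outMass K φ Δ := by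
    calc 2 * η * t = N * ((η / N - -(η / N)) * t) := by
          field_simp
          ring
      _ ≤ _ := by
          gcongr
          exact h1.trans h2
  linarith

theorem norm_outerPart_qft_le {N K : ℕ} (h : 2 * K + 1 ≤ N) {φ : RegState N} (hφ : ‖φ‖ = 1)
    {η b : ℝ} (hη : 0 ≤ η) (hη2 : η ≤ 1 / 2) (hb : 0 ≤ b)
    (hlt : 1 - avgSuccessProb K φ < 2 * η * b ^ 2) :
    ‖outerPart K (qft φ)‖ ≤ b + 2 * π * η := by
  have hN : (0 : ℝ) < N := by
    have : 0 < N := by omega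
    exact_mod_cast this
  have hpi := Real.pi_pos
  obtain ⟨Δ, hΔ, hm⟩ := exists_outMass_lt h φ hη hη2 (t := b ^ 2) (by rwa [hφ, one_pow])
  have e : qft φ = qft (modulate φ Δ) + qft (φ - modulate φ Δ) := by
    rw [qft_sub]
    abel
  rw [e, outerPart_add]
  refine (norm_add_le _ _).trans (add_le_add ?_ ?_)
  · rw [← norm_sq_outerPart_qft_modulate] at hm
    exact ((sq_lt_sq₀ (norm_nonneg _) hb).mp hm).le
  · refine (norm_outerPart_le K _).trans ?_
    rw [norm_qft]
    refine (norm_sub_modulate_le φ Δ).trans ?_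
    rw [hφ, mul_one]
    calc 2 * π * N * |Δ| ≤ 2 * π * N * (η / N) := by gcongr
      _ = 2 * π * η := by field_simp

/-- Normalizing moves y by |1 - ‖y‖|, which is at most ‖x - y‖ because ‖x‖ = 1. -/
theorem norm_normalize_sub_le {E : Type*} [NormedAddCommGroup E] [NormedSpace ℂ E] {x y : E}
    (hx : ‖x‖ = 1) (hy : y ≠ 0) : ‖((‖y‖ : ℝ) : ℂ)⁻¹ • y - x‖ ≤ 2 * ‖x - y‖ := by
  have hy' : ‖y‖ ≠ 0 := norm_ne_zero_iff.mpr hy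
  have h1 : ‖((‖y‖ : ℝ) : ℂ)⁻¹ • y - y‖ ≤ ‖x - y‖ := by
    have e : ((‖y‖ : ℝ) : ℂ)⁻¹ • y - y = (((‖y‖)⁻¹ - 1 : ℝ) : ℂ) • y := by
      push_cast
      rw [sub_smul, one_smul]
    rw [e, norm_smul, Complex.norm_real, Real.norm_eq_abs]
    nth_rw 2 [← abs_of_nonneg (norm_nonneg y)]
    rw [← abs_mul, sub_mul, inv_mul_cancel₀ hy', one_mul, ← hx]
    exact abs_norm_sub_norm_le x y
  calc ‖((‖y‖ : ℝ) : ℂ)⁻¹ • y - x‖ = ‖(((‖y‖ : ℝ) : ℂ)⁻¹ • y - y) - (x - y)‖ := by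
        congr 1
        abel
    _ ≤ _ := (norm_sub_le _ _).trans (by linarith)

/-- The inverse transform is an isometry, so the comparison takes place among frequency amplitudes.
Outer norm below 1 ensures that the truncated vector is nonzero and can be normalized. -/
theorem approxTaper_spec {N K : ℕ} {φ : RegState N} (hφ : ‖φ‖ = 1)
    (hlt : ‖outerPart K (qft φ)‖ < 1) :
    ‖approxTaper K φ‖ = 1 ∧ ‖approxTaper K φ - φ‖ ≤ 2 * ‖outerPart K (qft φ)‖ := by
  have hq : ‖qft φ‖ = 1 := by rw [norm_qft, hφ]
  have hsub := sub_extendByZero_centralAmplitudes K φ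
  have hne : extendByZero (centralAmplitudes K φ) ≠ 0 := by
    intro h0
    rw [h0, sub_zero] at hsub
    rw [← hsub, hq] at hlt
    exact lt_irrefl _ hlt
  unfold approxTaper prepareState
  constructor
  · rw [norm_invQft, norm_smul, norm_inv, Complex.norm_real, norm_norm,
      inv_mul_cancel₀ (norm_ne_zero_iff.mpr hne)]
  · nth_rw 3 [← invQft_qft φ]
    rw [← invQft_sub, norm_invQft, ← hsub]
    exact norm_normalize_sub_le hq hne

/-! ### Choice of parameters -/

theorem one_le_log_ten_div {ε : ℝ} (h0 : 0 < ε) (h1 : ε ≤ 1) : 1 ≤ Real.log (10 / ε) := by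
  rw [Real.le_log_iff_exp_le (by positivity)]
  have h2 := Real.exp_one_lt_d9
  have h3 : (10 : ℝ) ≤ 10 / ε := by
    rw [le_div_iff₀ h0]
    linarith
  linarith

theorem exists_concentration_le {ε : ℝ} (h0 : 0 < ε) (h1 : ε ≤ 1) {K : ℕ}
    (hK : 175 * (Real.log (10 / ε) + 1) ^ 2 ≤ K) :
    ∃ s : ℕ, (s + 1 : ℝ) * ((s + 1) / (2 * K + 1)) ^ (2 * s) ≤ (ε / 10) ^ 4 := by
  have hL := one_le_log_ten_div h0 h1
  have hexp : (ε / 10) ^ 4 = Real.exp (-(4 * Real.log (10 / ε))) := by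
    have h : ε / 10 = Real.exp (-Real.log (10 / ε)) := by
      rw [Real.exp_neg, Real.exp_log (by positivity), inv_div]
    rw [h, ← Real.exp_nat_mul]
    congr 1
    push_cast
    ring
  set L := Real.log (10 / ε) with hLdef
  -- With ratio ρ = (s+1)/(2K+1) ≤ 1/e, this s gives 2s - 1 ≥ 4L, the exponent needed for (ε/10)^4.
  obtain ⟨s, hs⟩ : ∃ s, s = ⌈3 * (L + 1)⌉₊ := ⟨_, rfl⟩
  have hs1 : 3 * (L + 1) ≤ s := hs ▸ Nat.le_ceil _
  have hs2 : (s : ℝ) < 3 * (L + 1) + 1 := hs ▸ Nat.ceil_lt_add_one (by linarith)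
  have hs3 : (s : ℝ) + 1 ≤ 4 * (L + 1) := by linarith
  have hspos : 1 ≤ s := by
    have : (1 : ℝ) ≤ s := by linarith
    exact_mod_cast this
  have hD : (0 : ℝ) < 2 * K + 1 := by positivity
  have hρ1 : ((s : ℝ) + 1) / (2 * K + 1) ≤ Real.exp (-1) := by
    have : ((s : ℝ) + 1) / (2 * K + 1) ≤ 1 / 3 := by
      rw [div_le_iff₀ hD]
      nlinarith
    refine this.trans ?_
    rw [Real.exp_neg, one_div]
    exact inv_anti₀ (Real.exp_pos 1) (by linarith [Real.exp_one_lt_d9])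
  -- One factor ρ absorbs the prefactor s + 1. Since (s+1)² ≤ 16(L+1)², a constant far smaller than
  -- 175 would suffice.
  have hρ2 : ((s : ℝ) + 1) * (((s : ℝ) + 1) / (2 * K + 1)) ≤ 1 := by
    rw [← mul_div_assoc, div_le_one hD]
    nlinarith [mul_le_mul hs3 hs3 (by positivity) (by positivity)]
  refine ⟨s, ?_⟩
  have e : 2 * s = (2 * s - 1) + 1 := by omega
  calc ((s : ℝ) + 1) * ((s + 1) / (2 * K + 1)) ^ (2 * s)
      = (((s : ℝ) + 1) * ((s + 1) / (2 * K + 1))) * ((s + 1) / (2 * K + 1)) ^ (2 * s - 1) := by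
        rw [e, pow_succ, ← e]
        ring
    _ ≤ 1 * Real.exp (-1) ^ (2 * s - 1) := by gcongr
    _ = Real.exp (-(2 * s - 1)) := by
        rw [one_mul, ← Real.exp_nat_mul, Nat.cast_sub (by omega)]
        congr 1
        push_cast
        ring
    _ ≤ _ := by
        rw [hexp, Real.exp_le_exp]
        linarith

theorem isBigO_two_mul_ceil_add_one :
    (fun ε : ℝ => ((2 * ⌈175 * (Real.log (10 / ε) + 1) ^ 2⌉₊ + 1 : ℕ) : ℝ))
      =O[𝓝[>] (0 : ℝ)] (fun ε : ℝ => Real.log (1 / ε) ^ 2) := by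
  have hlog : Real.log 10 ≤ 9 := by
    have := Real.log_le_sub_one_of_pos (show (0 : ℝ) < 10 by norm_num)
    linarith
  have hlog0 : 0 ≤ Real.log 10 := Real.log_nonneg (by norm_num)
  -- For ε < 1/e one has log(1/ε) ≥ 1, so log(10/ε) + 1 ≤ (9 + 1 + 1) log(1/ε). The 3 covers the
  -- rounding of the ceiling, doubled, and the final + 1.
  refine IsBigO.of_bound (350 * 11 ^ 2 + 3) ?_
  filter_upwards [Ioo_mem_nhdsGT (Real.exp_pos (-1))] with ε hε
  have h0 : 0 < ε := hε.1
  have hl : 1 ≤ Real.log (1 / ε) := by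
    rw [one_div, Real.log_inv]
    have := (Real.log_lt_iff_lt_exp h0).mpr hε.2
    linarith
  have hsplit : Real.log (10 / ε) = Real.log 10 + Real.log (1 / ε) := by
    rw [← Real.log_mul (by norm_num) (by positivity)]
    congr 1
    ring
  have hle : (Real.log (10 / ε) + 1) ^ 2 ≤ (11 * Real.log (1 / ε)) ^ 2 :=
    pow_le_pow_left₀ (by linarith) (by linarith) 2
  have hceil : (⌈175 * (Real.log (10 / ε) + 1) ^ 2⌉₊ : ℝ) <
      175 * (Real.log (10 / ε) + 1) ^ 2 + 1 := Nat.ceil_lt_add_one (by positivity)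
  rw [Real.norm_of_nonneg (by positivity), Real.norm_of_nonneg (by positivity)]
  push_cast
  nlinarith

theorem lemma1 :
    (∃ C : ℝ, 0 < C ∧
      ∀ ε : ℝ, 0 < ε → ε ≤ 1 →
      ∀ K N' : ℕ, K = ⌈175 * (Real.log (10 / ε) + 1) ^ 2⌉₊ →
        N' = 2 * ⌈175 * (Real.log (10 / ε) + 1) ^ 2⌉₊ + 1 →
      ∀ N : ℕ, N' ≤ N →
      ∀ φ : RegState N, IsDPSSTaper N K φ →
        1 - avgSuccessProb K φ ≤ ε ∧
        (centralPoints N K).card = N' ∧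
        ‖approxTaper K φ‖ = 1 ∧
        ‖approxTaper K φ - φ‖ ≤ C * ε) ∧
    (fun ε : ℝ => ((2 * ⌈175 * (Real.log (10 / ε) + 1) ^ 2⌉₊ + 1 : ℕ) : ℝ))
      =O[𝓝[>] (0 : ℝ)] (fun ε : ℝ => Real.log (1 / ε) ^ 2) := by
  refine ⟨⟨1, one_pos, ?_⟩, isBigO_two_mul_ceil_add_one⟩
  rintro ε h0 h1 K N' hK rfl N hN φ hφ
  rw [← hK] at hN ⊢
  obtain ⟨s, hs⟩ := exists_concentration_le h0 h1 (K := K) (hK ▸ Nat.le_ceil _)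
  have hδ := (hφ.one_sub_avgSuccessProb_le hN s).trans hs
  have hε3 : ε ^ 3 ≤ 1 := pow_le_one₀ h0.le h1
  -- The hypothesis reads (ε/10)^4 < 2(ε/20)(ε/10)² = ε³/1000. The resulting bound ε/10 + 2πε/20 is
  -- at most ε/2 since π < 4, and doubling it gives C = 1.
  have hout := norm_outerPart_qft_le hN hφ.1 (η := ε / 20) (b := ε / 10) (by positivity)
    (by linarith) (by positivity)
    (by
      have : 0 < ε ^ 3 := by positivity
      nlinarith)
  have hhalf : ‖outerPart K (qft φ)‖ ≤ ε / 2 := by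
    have := Real.pi_lt_four
    nlinarith
  obtain ⟨hn, hd⟩ := approxTaper_spec hφ.1 (lt_of_le_of_lt hhalf (by linarith))
  exact ⟨hδ.trans (by nlinarith), card_centralPoints hN, hn, by linarith⟩
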